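/- Consider the Poisson topic model: a label $y\in\{0,1\}$ is drawn from a Bernoulli law, then a topic $\tau\in\Theta$ from a law $\rho_y$, then, given $\tau$, independent word counts $x_j\sim\mathrm{Poisson}(\lambda^{(\tau)}_j)$, $j=1,\dots,d$, with $\lambda^{(\tau)}_j\in[0,\infty)$. Let $\delta\in(0,1)$, and let $\tilde x$ be obtained from $x$ by binomial dropout: given $x$, the $\tilde x_j\sim\mathrm{Binom}(x_j,1-\delta)$ are independent. Fix a topic $\tau$ and weights $w\in\mathbb R^d$ with $\sum_j\lambda^{(\tau)}_jw_j^2>0$, and consider the linear classifier $x\mapsto \mathbf 1\{w\cdot x>0\}$. Let $c_\tau\in\arg\max_{c\in\{0,1\}}\mathbb P[y=c\mid\tau]$ be the more likely label given $\tau$ (either one in case of a tie), and let $$\varepsilon_\tau=\mathbb P\big[\mathbf 1\{w\cdot x>0\}\ne c_\tau\mid\tau\big],\qquad \tilde\varepsilon_\tau=\mathbb P\big[\mathbf 1\{w\cdot\tilde x>0\}\ne c_\tau\mid\tau\big],\qquad \Psi_\tau=\frac{\max_j w_j^2}{\sum_{j=1}^d\lambda^{(\tau)}_jw_j^2}.$$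 Then $\varepsilon_\tau=\widetilde O\big(\tilde\varepsilon_\tau^{1/(1-\delta)}+\sqrt{\Psi_\tau}\big)$ with constants that depend only on $\delta$; precisely, there is a constant $C_\delta>0$ that depends only on $\delta$ such that $$\varepsilon_\tau\le C_\delta\left(\tilde\varepsilon_\tau^{\frac1{1-\delta}}\cdot\max\Big\{1,\sqrt{-\log\tilde\varepsilon_\tau}^{\,\frac{\delta}{1-\delta}}\Big\}+\sqrt{\Psi_\tau}\right),$$ where the first summand is read as $0$ if $\tilde\varepsilon_\tau=0$. -/

import Mathlib

open MeasureTheory ProbabilityTheory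
open scoped NNReal unitInterval

/-- Count vectors over a vocabulary of `d` words. -/
abbrev Counts (d : ℕ) : Type := Fin d → ℕ

/-- The product law of `d` independent Poisson counts with means `r j`. -/
noncomputable def poissonCounts {d : ℕ} (r : Fin d → ℝ≥0) : Measure (Counts d) :=
  Measure.pi fun j => poissonMeasure (r j)

instance {d : ℕ} (r : Fin d → ℝ≥0) : IsProbabilityMeasure (poissonCounts r) := by
  unfold poissonCounts; infer_instance

theorem measurable_poissonCounts {d : ℕ} : Measurable (poissonCounts (d := d)) := by
  refine Measure.measurable_of_measurable_coe _ fun s hs => ?_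
  have hsum : ∀ r : Fin d → ℝ≥0, poissonCounts r s =
      ∑' x : Counts d, s.indicator (fun x => ∏ j, poissonMeasure (r j) {x j}) x := by
    intro r
    rw [← Measure.tsum_indicator_apply_singleton (poissonCounts r) s hs]
    refine tsum_congr fun x => ?_
    by_cases hx : x ∈ s
    · simp only [Set.indicator_of_mem hx, poissonCounts, Measure.pi_singleton]
    · simp only [Set.indicator_of_notMem hx]
  simp_rw [hsum]
  refine Measurable.tsum fun x => ?_
  by_cases hx : x ∈ s
  · simp only [Set.indicator_of_mem hx, poissonMeasure_singleton]
    fun_prop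
  · simp only [Set.indicator_of_notMem hx]
    fun_prop

/-- The Poisson topic model over the topic space `Θ` with a vocabulary of `d` words
(`true` is the label `1`, `false` is the label `0`): a label is drawn from the Bernoulli law
`label`, then a topic from `topic y`, then independent Poisson counts with means `rate τ j`. -/
structure PoissonTopicModel (Θ : Type*) [MeasurableSpace Θ] (d : ℕ) where
  label : Measure Bool
  isProbabilityMeasure_label : IsProbabilityMeasure label
  topic : Kernel Bool Θ
  isMarkovKernel_topic : IsMarkovKernel topic
  rate : Θ → Fin d → ℝ≥0
  measurable_rate : Measurable rate

attribute [instance] PoissonTopicModel.isProbabilityMeasure_label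
  PoissonTopicModel.isMarkovKernel_topic

/-- Binomial dropout with dropout probability `δ`: given the counts `x`, the thinned counts are
independent and the `j`-th one has the law `Binom(x j, 1 - δ)`. -/
noncomputable def binomialDropout (d : ℕ) (δ : I) : Kernel (Counts d) (Counts d) where
  toFun x := Measure.pi fun j => binomial (x j) (σ δ)
  measurable' := Measurable.of_discrete

/-- The label that the linear classifier with weights `w` predicts: `1` iff `w · x > 0`. -/
noncomputable def linearPrediction {d : ℕ} (w : Fin d → ℝ) (x : Counts d) : Bool :=
  decide (0 < ∑ j, w j * (x j : ℝ))

namespace PoissonTopicModel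

variable {Θ : Type*} [MeasurableSpace Θ] {d : ℕ} (M : PoissonTopicModel Θ d)

/-- The conditional law of the label given the topic. -/
noncomputable def labelGivenTopic : Kernel Θ Bool := posterior M.topic M.label

/-- `c` is a more likely label given the topic `τ`, that is, `c` maximizes `P(y = c | τ)`
(both labels do in case of a tie). -/
def IsMostLikelyLabel (τ : Θ) (c : Bool) : Prop :=
  ∀ c' : Bool, (M.labelGivenTopic τ).real {c'} ≤ (M.labelGivenTopic τ).real {c}

/-- The conditional law of the features `x` given the topic. -/
noncomputable def featuresGivenTopic : Kernel Θ (Counts d) where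
  toFun τ := poissonCounts (M.rate τ)
  measurable' := measurable_poissonCounts.comp M.measurable_rate

/-- The conditional law of the features thinned by binomial dropout given the topic. -/
noncomputable def dropoutFeaturesGivenTopic (δ : I) : Kernel Θ (Counts d) :=
  binomialDropout d δ ∘ₖ M.featuresGivenTopic

/-- The probability, in the original measure given the topic `τ`, that the classifier `w`
predicts something else than the label `c`. -/
noncomputable def errorRate (w : Fin d → ℝ) (τ : Θ) (c : Bool) : ℝ :=
  (M.featuresGivenTopic τ).real {x | linearPrediction w x ≠ c}

/-- The probability, in the dropout measure given the topic `τ`, that the classifier `w`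
predicts something else than the label `c`. -/
noncomputable def dropoutErrorRate (δ : I) (w : Fin d → ℝ) (τ : Θ) (c : Bool) : ℝ :=
  (M.dropoutFeaturesGivenTopic δ τ).real {x | linearPrediction w x ≠ c}

/-- `Ψ = max_j (w j)² / ∑ j, λ_j (w j)²`, with `λ_j` the word rates of the topic `τ`. -/
noncomputable def weightImbalance (w : Fin d → ℝ) (τ : Θ) : ℝ :=
  (⨆ j, w j ^ 2) / ∑ j, (M.rate τ j : ℝ) * w j ^ 2

end PoissonTopicModel

/-!
Write `p = 1 - δ`. Binomial thinning turns independent Poisson counts with rates `λ` into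
independent Poisson counts with rates `p λ` (`binomialDropout_comp_poissonCounts`). So both error
rates are probabilities that a weighted sum of independent Poisson counts falls on one side of `0`;
thinning multiplies its mean and its variance by `p`, hence its standardized margin by `√p`.

*Normal approximation.* Up to a constant times `√Ψ`, the two error rates are `Φ s` and `Φ (√p s)`
for one real `s` (`abs_measureReal_linearPrediction_ne_sub_stdCDF_le`). This is a Berry-Esseen bound
proved by Stein's method. Size-biasing a Poisson count adds one to it, so for the standardized sum
`W = ∑ u j * (x j - λ j)` with `∑ λ j * u j ^ 2 = 1` one has the exact identity
`E[W f(W)] = ∑ λ j * u j * E[f(W + u j) - f(W)]` (`integral_centeredSum_mul`). Let `f` solve the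
Stein equation `f' w = w f w + 1_{w ≤ z} - Φ z`. An increment of `f` over a step of size at most
`b = max |u j|` is an integral of `f'`, and along the step the term `w f w` moves by
`O(b (1 + |w|))` while the indicator stays between the indicators with jumps at `z - b` and `z + b`
(`mul_steinSol_sub_mem_Icc`). Averaging with the weights `λ j * u j ^ 2` cancels `E[W f(W)]`
and leaves `P(W ≤ z - b) - O(b) ≤ Φ z ≤ P(W ≤ z + b) + O(b)`; here `b = √Ψ`.

*Gaussian tails.* If `Φ (√p s)` is at most a multiple of `√Ψ`, then so is `Φ s`. Otherwise the
dropout error `e` is within a factor of two of `Φ (√p s)`. Put `x = -√p s`. For `x ≤ 2` the tail, and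
with it `e`, is bounded away from zero. For `x > 2` the two-sided Mills bounds give
`e ^ (1 / p) ≳ exp (-s ^ 2 / 2) * x ^ (-1 / p)` and `√(-log e) ≳ x`, and since `1 / p = 1 + δ / p`
the product `e ^ (1 / p) * √(-log e) ^ (δ / p)` dominates `exp (-s ^ 2 / 2) / x`, which dominates
`Φ s` (`stdCDF_le_const_mul_rpow`).
-/

open Filter Set Topology

/-! ### The standard Gaussian distribution -/

/-- The standard Gaussian density. -/
noncomputable def stdDensity (x : ℝ) : ℝ := gaussianPDFReal 0 1 x

/-- The standard Gaussian distribution function. -/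
noncomputable def stdCDF (x : ℝ) : ℝ := cdf (gaussianReal 0 1) x

theorem stdDensity_eq (x : ℝ) : stdDensity x = (√(2 * Real.pi))⁻¹ * Real.exp (-x ^ 2 / 2) := by
  simp [stdDensity, gaussianPDFReal]

theorem stdDensity_pos (x : ℝ) : 0 < stdDensity x := gaussianPDFReal_pos _ _ _ one_ne_zero

theorem stdDensity_neg (x : ℝ) : stdDensity (-x) = stdDensity x := by simp [stdDensity_eq]

theorem stdDensity_le_exp (x : ℝ) : stdDensity x ≤ Real.exp (-x ^ 2 / 2) := by
  rw [stdDensity_eq]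
  refine mul_le_of_le_one_left (Real.exp_pos _).le (inv_le_one_of_one_le₀ ?_)
  exact Real.one_le_sqrt.2 (by linarith [Real.pi_gt_three])

theorem stdDensity_le_one (x : ℝ) : stdDensity x ≤ 1 :=
  (stdDensity_le_exp x).trans (Real.exp_le_one_iff.2 (by nlinarith [sq_nonneg x]))

theorem hasDerivAt_stdDensity (x : ℝ) : HasDerivAt stdDensity (-(x * stdDensity x)) x := by
  have h : HasDerivAt (fun y : ℝ => (√(2 * Real.pi))⁻¹ * Real.exp (-y ^ 2 / 2))
      ((√(2 * Real.pi))⁻¹ * (Real.exp (-x ^ 2 / 2) * (-(2 * x) / 2))) x := by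
    refine HasDerivAt.const_mul _ (HasDerivAt.exp ?_)
    simpa using ((hasDerivAt_pow 2 x).neg.div_const 2)
  rw [show stdDensity = fun y : ℝ => (√(2 * Real.pi))⁻¹ * Real.exp (-y ^ 2 / 2) from
    funext stdDensity_eq]
  convert h using 1
  ring

theorem continuous_stdDensity : Continuous stdDensity :=
  continuous_iff_continuousAt.2 fun x => (hasDerivAt_stdDensity x).continuousAt

theorem tendsto_stdDensity_atTop : Tendsto stdDensity atTop (𝓝 0) := by
  refine squeeze_zero' (Eventually.of_forall fun x => (stdDensity_pos x).le)
    (g := fun x => Real.exp (-x)) ?_ Real.tendsto_exp_neg_atTop_nhds_zero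
  filter_upwards [eventually_ge_atTop 2] with x hx
  exact (stdDensity_le_exp x).trans (Real.exp_le_exp.2 (by nlinarith))

theorem stdCDF_nonneg (x : ℝ) : 0 ≤ stdCDF x := cdf_nonneg _ x

theorem stdCDF_le_one (x : ℝ) : stdCDF x ≤ 1 := cdf_le_one _ x

theorem monotone_stdCDF : Monotone stdCDF := monotone_cdf _

theorem stdCDF_eq_integral (x : ℝ) : stdCDF x = ∫ t in Iic x, stdDensity t := by
  rw [stdCDF, cdf_eq_real, measureReal_def, gaussianReal_apply_eq_integral 0 one_ne_zero,
    ENNReal.toReal_ofReal]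
  · rfl
  · exact integral_nonneg fun t => gaussianPDFReal_nonneg _ _ _

theorem hasDerivAt_stdCDF (x : ℝ) : HasDerivAt stdCDF (stdDensity x) x := by
  have hint : Integrable stdDensity := integrable_gaussianPDFReal 0 1
  have h : stdCDF = fun y => stdCDF 0 + ∫ t in (0 : ℝ)..y, stdDensity t := by
    funext y
    rw [← intervalIntegral.integral_Iic_sub_Iic hint.integrableOn hint.integrableOn,
      ← stdCDF_eq_integral, ← stdCDF_eq_integral]
    ring
  rw [h]
  exact (intervalIntegral.integral_hasDerivAt_right hint.intervalIntegrable
    (continuous_stdDensity.stronglyMeasurableAtFilter _ _)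
    continuous_stdDensity.continuousAt).const_add _

theorem continuous_stdCDF : Continuous stdCDF :=
  continuous_iff_continuousAt.2 fun x => (hasDerivAt_stdCDF x).continuousAt

theorem stdCDF_neg (x : ℝ) : stdCDF (-x) = 1 - stdCDF x := by
  have hG : NullSingletonClass (gaussianReal 0 1) := nullSingletonClass_gaussianReal one_ne_zero
  have h : (gaussianReal 0 1).real (Iic (-x)) = (gaussianReal 0 1).real (Ici x) := by
    conv_lhs => rw [← neg_zero, ← gaussianReal_map_neg]
    rw [map_measureReal_apply measurable_neg measurableSet_Iic]
    congr 1
    ext y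
    simp
  rw [stdCDF, stdCDF, cdf_eq_real, cdf_eq_real, h, ← probReal_compl_eq_one_sub measurableSet_Iic,
    compl_Iic]
  exact (measureReal_congr Ioi_ae_eq_Ici).symm

theorem tendsto_stdCDF_neg_atTop : Tendsto (fun x => stdCDF (-x)) atTop (𝓝 0) :=
  (tendsto_cdf_atBot _).comp tendsto_neg_atTop_atBot

theorem hasDerivAt_stdCDF_neg (x : ℝ) :
    HasDerivAt (fun y => stdCDF (-y)) (-stdDensity x) x := by
  refine ((hasDerivAt_stdCDF (-x)).comp x (hasDerivAt_neg x)).congr_deriv ?_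
  rw [stdDensity_neg, mul_neg_one]

/-- The distribution function is `1`-Lipschitz, since the density is at most `1`. -/
theorem stdCDF_add_le (x : ℝ) {b : ℝ} (hb : 0 ≤ b) : stdCDF (x + b) ≤ stdCDF x + b := by
  have hd : Differentiable ℝ stdCDF := fun y => (hasDerivAt_stdCDF y).differentiableAt
  have h := image_sub_le_mul_sub_of_deriv_le hd (C := 1)
    (fun y => by rw [(hasDerivAt_stdCDF y).deriv]; exact stdDensity_le_one y)
    (show x ≤ x + b by linarith)
  linarith

/-! ### Mills bounds -/

theorem nonneg_of_deriv_nonpos_of_tendsto_zero {h h' : ℝ → ℝ} {x : ℝ}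
    (hd : ∀ y, x ≤ y → HasDerivAt h (h' y) y) (hn : ∀ y, x ≤ y → h' y ≤ 0)
    (hl : Tendsto h atTop (𝓝 0)) : 0 ≤ h x := by
  have ha : AntitoneOn h (Ici x) := by
    refine antitoneOn_of_deriv_nonpos (convex_Ici x)
      (fun y hy => (hd y hy).continuousAt.continuousWithinAt) ?_ ?_
    · intro y hy
      exact (hd y (interior_subset hy)).differentiableAt.differentiableWithinAt
    · intro y hy
      rw [(hd y (interior_subset hy)).deriv]
      exact hn y (interior_subset hy)
  refine le_of_tendsto hl ?_
  filter_upwards [eventually_ge_atTop x] with y hy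
  exact ha self_mem_Ici hy hy

/-- The upper Mills bound: `φ x / x - Φ (-x)` decreases to zero on the positive half-line. -/
theorem mul_stdCDF_neg_le {x : ℝ} (hx : 0 < x) : x * stdCDF (-x) ≤ stdDensity x := by
  have h : 0 ≤ stdDensity x / x - stdCDF (-x) := by
    refine nonneg_of_deriv_nonpos_of_tendsto_zero (h := fun y => stdDensity y / y - stdCDF (-y))
      (h' := fun y => -(stdDensity y / y ^ 2)) ?_ ?_ ?_
    · intro y hy
      have hy0 : y ≠ 0 := (hx.trans_le hy).ne'
      refine (((hasDerivAt_stdDensity y).div (hasDerivAt_id' y) hy0).sub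
        (hasDerivAt_stdCDF_neg y)).congr_deriv ?_
      field_simp
      ring
    · intro y _
      have := stdDensity_pos y
      have : 0 ≤ stdDensity y / y ^ 2 := by positivity
      linarith
    · simpa using (tendsto_stdDensity_atTop.div_atTop tendsto_id).sub tendsto_stdCDF_neg_atTop
  have h2 := mul_le_mul_of_nonneg_left (sub_nonneg.1 h) hx.le
  rwa [mul_div_cancel₀ _ hx.ne'] at h2

/-- The lower Mills bound: the difference of the two sides decreases to zero at infinity. -/
theorem le_stdCDF_neg (x : ℝ) : stdDensity x * (x / (1 + x ^ 2)) ≤ stdCDF (-x) := by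
  have h : 0 ≤ stdCDF (-x) - stdDensity x * (x / (1 + x ^ 2)) := by
    refine nonneg_of_deriv_nonpos_of_tendsto_zero
      (h := fun y => stdCDF (-y) - stdDensity y * (y / (1 + y ^ 2)))
      (h' := fun y => -(stdDensity y * (2 / (1 + y ^ 2) ^ 2))) ?_ ?_ ?_
    · intro y _
      have hy0 : 1 + y ^ 2 ≠ 0 := by positivity
      have h1 : HasDerivAt (fun y : ℝ => 1 + y ^ 2) (2 * y) y := by
        simpa using (hasDerivAt_pow 2 y).const_add 1
      refine ((hasDerivAt_stdCDF_neg y).sub ((hasDerivAt_stdDensity y).mul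
        ((hasDerivAt_id' y).div h1 hy0))).congr_deriv ?_
      simp only [Pi.div_apply]
      field_simp
      ring
    · intro y _
      have := stdDensity_pos y
      have : 0 ≤ stdDensity y * (2 / (1 + y ^ 2) ^ 2) := by positivity
      linarith
    · have h0 : Tendsto (fun y => stdDensity y * (y / (1 + y ^ 2))) atTop (𝓝 0) := by
        refine squeeze_zero' ?_ ?_ tendsto_stdDensity_atTop
        · filter_upwards [eventually_ge_atTop 0] with y hy
          have := stdDensity_pos y
          positivity
        · filter_upwards with y
          refine mul_le_of_le_one_right (stdDensity_pos y).le ?_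
          rw [div_le_one (by positivity)]
          nlinarith [sq_nonneg (y - 1)]
      simpa using tendsto_stdCDF_neg_atTop.sub h0
  exact sub_nonneg.1 h

theorem stdCDF_pos (x : ℝ) : 0 < stdCDF x := by
  have h := le_stdCDF_neg (max (-x) 1)
  have h1 : 0 < stdDensity (max (-x) 1) * (max (-x) 1 / (1 + max (-x) 1 ^ 2)) := by
    have := stdDensity_pos (max (-x) 1)
    have : 0 < max (-x) 1 := lt_max_of_lt_right one_pos
    positivity
  refine (h1.trans_le h).trans_le (monotone_stdCDF ?_)
  linarith [le_max_left (-x) 1]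

/-! ### Solutions of the Stein equation -/

/-- The solution of the Stein equation `f' w - w f w = 1_{w ≤ z} - Φ z`, in the symmetric form
`Φ (min w z) Φ (-max w z) / φ w`. -/
noncomputable def steinSol (z w : ℝ) : ℝ :=
  stdCDF (min w z) * stdCDF (-max w z) / stdDensity w

theorem continuous_steinSol (z : ℝ) : Continuous (steinSol z) := by
  unfold steinSol
  refine Continuous.div ?_ continuous_stdDensity fun w => (stdDensity_pos w).ne'
  exact (continuous_stdCDF.comp (by fun_prop)).mul (continuous_stdCDF.comp (by fun_prop))

theorem steinSol_nonneg (z w : ℝ) : 0 ≤ steinSol z w :=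
  div_nonneg (mul_nonneg (stdCDF_nonneg _) (stdCDF_nonneg _)) (stdDensity_pos w).le

/-- Stein solutions are dominated by the Mills ratio at `|w|`, which gives both bounds below. -/
theorem steinSol_le_mills (z w : ℝ) : steinSol z w ≤ stdCDF (-|w|) / stdDensity |w| := by
  have hd : stdDensity |w| = stdDensity w := by simp [stdDensity_eq]
  rw [hd]
  refine div_le_div_of_nonneg_right ?_ (stdDensity_pos w).le
  rcases le_total 0 w with hw | hw
  · rw [abs_of_nonneg hw]
    exact (mul_le_of_le_one_left (stdCDF_nonneg _) (stdCDF_le_one _)).trans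
      (monotone_stdCDF (neg_le_neg (le_max_left w z)))
  · rw [abs_of_nonpos hw, neg_neg]
    exact (mul_le_of_le_one_right (stdCDF_nonneg _) (stdCDF_le_one _)).trans
      (monotone_stdCDF (min_le_left w z))

theorem abs_mul_steinSol_le_one (z w : ℝ) : |w| * steinSol z w ≤ 1 := by
  rcases eq_or_lt_of_le (abs_nonneg w) with hw | hw
  · simp [← hw]
  · refine (mul_le_mul_of_nonneg_left (steinSol_le_mills z w) hw.le).trans ?_
    rw [← mul_div_assoc, div_le_one (stdDensity_pos _)]
    exact mul_stdCDF_neg_le hw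

/-- A uniform bound for the Stein solutions: off `[-1, 1]` the product with `|w|` is at most `1`,
and on `[-1, 1]` the density is at least `φ 1`. -/
theorem steinSol_le (z w : ℝ) : steinSol z w ≤ (stdDensity 1)⁻¹ := by
  have h1 : 1 ≤ (stdDensity 1)⁻¹ := (one_le_inv₀ (stdDensity_pos 1)).2 (stdDensity_le_one 1)
  rcases le_total 1 |w| with hw | hw
  · refine le_trans ?_ h1
    exact (le_mul_of_one_le_left (steinSol_nonneg z w) hw).trans (abs_mul_steinSol_le_one z w)
  · have hd : stdDensity 1 ≤ stdDensity w := by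
      rw [stdDensity_eq, stdDensity_eq]
      have : w ^ 2 ≤ 1 := by rw [← sq_abs]; exact pow_le_one₀ (abs_nonneg w) hw
      refine mul_le_mul_of_nonneg_left (Real.exp_le_exp.2 ?_) (by positivity)
      linarith
    rw [steinSol, ← one_div]
    exact div_le_div₀ zero_le_one
      (mul_le_one₀ (stdCDF_le_one _) (stdCDF_nonneg _) (stdCDF_le_one _)) (stdDensity_pos 1) hd

/-- The Stein equation, off the jump `z` of its right-hand side. -/
theorem hasDerivAt_steinSol {z w : ℝ} (hw : w ≠ z) :
    HasDerivAt (steinSol z) (w * steinSol z w + (Iic z).indicator 1 w - stdCDF z) w := by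
  have hp := (stdDensity_pos w).ne'
  rcases hw.lt_or_gt with h | h
  · have he : steinSol z =ᶠ[𝓝 w] fun y => stdCDF y * stdCDF (-z) / stdDensity y := by
      filter_upwards [Iio_mem_nhds h] with y hy
      rw [steinSol, min_eq_left (le_of_lt hy), max_eq_right (le_of_lt hy)]
    refine HasDerivAt.congr_of_eventuallyEq ?_ he
    rw [he.eq_of_nhds, indicator_of_mem (show w ∈ Iic z from h.le), Pi.one_apply]
    refine (((hasDerivAt_stdCDF w).mul_const (stdCDF (-z))).div
      (hasDerivAt_stdDensity w) hp).congr_deriv ?_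
    rw [stdCDF_neg]
    field_simp
    ring
  · have he : steinSol z =ᶠ[𝓝 w] fun y => stdCDF z * stdCDF (-y) / stdDensity y := by
      filter_upwards [Ioi_mem_nhds h] with y hy
      rw [steinSol, min_eq_right (le_of_lt hy), max_eq_left (le_of_lt hy)]
    refine HasDerivAt.congr_of_eventuallyEq ?_ he
    rw [he.eq_of_nhds, indicator_of_notMem (by simpa using h)]
    refine (((hasDerivAt_stdCDF_neg w).const_mul (stdCDF z)).div
      (hasDerivAt_stdDensity w) hp).congr_deriv ?_
    rw [stdCDF_neg]
    field_simp
    ring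

/-- The fundamental theorem of calculus for the Stein solution, across the point `z`. -/
theorem intervalIntegrable_stein (z x y : ℝ) :
    IntervalIntegrable (fun w => w * steinSol z w + (Iic z).indicator 1 w - stdCDF z)
      volume x y := by
  refine IntervalIntegrable.sub (IntervalIntegrable.add ?_ ?_) intervalIntegrable_const
  · exact (continuous_id.mul (continuous_steinSol z)).intervalIntegrable x y
  · rw [intervalIntegrable_iff]
    exact (integrableOn_const (by simp)).indicator measurableSet_Iic

theorem steinSol_sub_eq_integral (z x y : ℝ) :
    steinSol z y - steinSol z x =
      ∫ w in x..y, (w * steinSol z w + (Iic z).indicator 1 w - stdCDF z) := by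
  refine (MeasureTheory.integral_eq_of_hasDerivAt_off_countable (s := {z}) _ _
    (countable_singleton z) (continuous_steinSol z).continuousOn
    (fun w hw => hasDerivAt_steinSol hw.2) ?_).symm
  exact intervalIntegrable_stein z x y

/-! ### Size-biasing and integration by parts for Poisson counts -/

theorem succ_mul_poissonMeasure_singleton (r : ℝ≥0) (n : ℕ) :
    ((n + 1 : ℕ) : ENNReal) * poissonMeasure r {n + 1} = r * poissonMeasure r {n} := by
  rw [poissonMeasure_singleton, poissonMeasure_singleton, ← ENNReal.ofReal_natCast,
    ← ENNReal.ofReal_coe_nnreal, ← ENNReal.ofReal_mul (by positivity),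
    ← ENNReal.ofReal_mul (by positivity), Nat.factorial_succ]
  congr 1
  push_cast
  field_simp
  ring

theorem poissonCounts_singleton {d : ℕ} (r : Fin d → ℝ≥0) (x : Counts d) :
    poissonCounts r {x} = ∏ j, poissonMeasure (r j) {x j} := by
  rw [poissonCounts, Measure.pi_singleton]

/-- Size-biasing a coordinate of a vector of independent Poisson counts adds one to it. -/
theorem poissonCounts_withDensity_coord {d : ℕ} (r : Fin d → ℝ≥0) (j : Fin d) :
    (poissonCounts r).withDensity (fun x => ((x j : ℝ≥0) : ENNReal)) =
      r j • (poissonCounts r).map (fun x => x + Pi.single j 1) := by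
  refine Measure.ext_of_singleton fun y => ?_
  rw [withDensity_apply _ (measurableSet_singleton y), lintegral_singleton, Measure.smul_apply,
    Measure.map_apply .of_discrete (measurableSet_singleton y)]
  rcases Nat.eq_zero_or_pos (y j) with h0 | h0
  · have he : (fun x : Counts d => x + Pi.single j 1) ⁻¹' {y} = ∅ := by
      ext x
      simp only [mem_preimage, mem_singleton_iff, mem_empty_iff_false, iff_false]
      rintro rfl
      simp at h0
    simp [he, h0]
  · obtain ⟨x, rfl⟩ : ∃ x : Counts d, y = x + Pi.single j 1 := by
      refine ⟨y - Pi.single j 1, ?_⟩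
      ext i
      by_cases hi : i = j
      · subst hi
        simp
        omega
      · simp [hi]
    have he : (fun x : Counts d => x + Pi.single j 1) ⁻¹' {x + Pi.single j 1} = {x} := by
      ext x'
      simp
    rw [he, poissonCounts_singleton, poissonCounts_singleton,
      ← Finset.mul_prod_erase _ _ (Finset.mem_univ j),
      ← Finset.mul_prod_erase _ (fun i => poissonMeasure (r i) {x i}) (Finset.mem_univ j),
      ← mul_assoc, ENNReal.smul_def, smul_eq_mul, ← mul_assoc]
    congr 1
    · simpa using succ_mul_poissonMeasure_singleton (r j) (x j)
    · refine Finset.prod_congr rfl fun i hi => ?_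
      simp [Finset.ne_of_mem_erase hi]

/-- The size-bias identity in integral form. No integrability is needed: for `r j = 0` both sides
vanish, and otherwise the two integrands are integrable or not together. -/
theorem integral_coord_mul_poissonCounts {d : ℕ} (r : Fin d → ℝ≥0) (j : Fin d)
    (g : Counts d → ℝ) :
    ∫ x, (x j : ℝ) * g x ∂poissonCounts r =
      r j * ∫ x, g (x + Pi.single j 1) ∂poissonCounts r := by
  have h := integral_withDensity_eq_integral_smul (μ := poissonCounts r)
    (f := fun x : Counts d => (x j : ℝ≥0)) .of_discrete g
  rw [poissonCounts_withDensity_coord, integral_smul_nnreal_measure,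
    integral_map .of_discrete .of_discrete] at h
  simpa [NNReal.smul_def] using h.symm

theorem integrable_coord_mul_poissonCounts {d : ℕ} (r : Fin d → ℝ≥0) (j : Fin d)
    {g : Counts d → ℝ} (hg : Integrable (fun x => g (x + Pi.single j 1)) (poissonCounts r)) :
    Integrable (fun x => (x j : ℝ) * g x) (poissonCounts r) := by
  have h := integrable_withDensity_iff_integrable_smul (μ := poissonCounts r)
    (f := fun x : Counts d => (x j : ℝ≥0)) .of_discrete (g := g)
  rw [poissonCounts_withDensity_coord] at h
  have h2 : Integrable g (r j • (poissonCounts r).map (fun x => x + Pi.single j 1)) :=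
    ((integrable_map_measure .of_discrete .of_discrete).2 hg).smul_measure_nnreal
  simpa [NNReal.smul_def] using h.1 h2

/-- The weighted sum of counts, centered at its mean under Poisson rates `r`. -/
noncomputable def centeredSum {d : ℕ} (r : Fin d → ℝ≥0) (u : Fin d → ℝ) (x : Counts d) : ℝ :=
  ∑ j, u j * ((x j : ℝ) - r j)

theorem centeredSum_add_single {d : ℕ} (r : Fin d → ℝ≥0) (u : Fin d → ℝ) (x : Counts d)
    (j : Fin d) : centeredSum r u (x + Pi.single j 1) = centeredSum r u x + u j := by
  have h : ∀ i, u i * (((x + Pi.single j 1 : Counts d) i : ℝ) - r i) =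
      u i * ((x i : ℝ) - r i) + if i = j then u j else 0 := by
    intro i
    by_cases hi : i = j
    · subst hi
      simp
      ring
    · simp [hi]
  simp only [centeredSum, h, Finset.sum_add_distrib, Finset.sum_ite_eq', Finset.mem_univ, if_true]

section

variable {d : ℕ} {r : Fin d → ℝ≥0} {u : Fin d → ℝ}

theorem centeredSum_mul (h : Counts d → ℝ) (x : Counts d) : centeredSum r u x * h x =
    ∑ j, u j * ((x j : ℝ) * h x - r j * h x) := by
  rw [centeredSum, Finset.sum_mul]
  exact Finset.sum_congr rfl fun j _ => by ring

theorem integrable_centeredSum_mul {h : Counts d → ℝ} (hh : Integrable h (poissonCounts r))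
    (hs : ∀ j, Integrable (fun x => h (x + Pi.single j 1)) (poissonCounts r)) :
    Integrable (fun x => centeredSum r u x * h x) (poissonCounts r) := by
  simp only [centeredSum_mul]
  exact integrable_finsetSum _ fun j _ =>
    ((integrable_coord_mul_poissonCounts r j (hs j)).sub (hh.const_mul _)).const_mul _

/-- Integration by parts for the centered sum: multiplication by the sum is dual to taking
increments in the coordinates. -/
theorem integral_centeredSum_mul {h : Counts d → ℝ} (hh : Integrable h (poissonCounts r))
    (hs : ∀ j, Integrable (fun x => h (x + Pi.single j 1)) (poissonCounts r)) :
    ∫ x, centeredSum r u x * h x ∂poissonCounts r =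
      ∫ x, ∑ j, r j * (u j * (h (x + Pi.single j 1) - h x)) ∂poissonCounts r := by
  have h1 : ∀ j, Integrable (fun x => u j * ((x j : ℝ) * h x - r j * h x)) (poissonCounts r) :=
    fun j => ((integrable_coord_mul_poissonCounts r j (hs j)).sub (hh.const_mul _)).const_mul _
  have h2 : ∀ j, Integrable (fun x => (r j : ℝ) * (u j * (h (x + Pi.single j 1) - h x)))
      (poissonCounts r) := fun j => (((hs j).sub hh).const_mul _).const_mul _
  simp only [centeredSum_mul]
  rw [integral_finsetSum _ fun j _ => h1 j, integral_finsetSum _ fun j _ => h2 j]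
  refine Finset.sum_congr rfl fun j _ => ?_
  rw [integral_const_mul, integral_sub (integrable_coord_mul_poissonCounts r j (hs j))
    (hh.const_mul _), integral_coord_mul_poissonCounts, integral_const_mul, integral_const_mul,
    integral_const_mul, integral_sub (hs j) hh]
  ring

theorem integrable_centeredSum : Integrable (centeredSum r u) (poissonCounts r) := by
  simpa using integrable_centeredSum_mul (r := r) (u := u) (h := fun _ => 1)
    (integrable_const _) (fun _ => integrable_const _)

theorem integrable_centeredSum_sq :
    Integrable (fun x => centeredSum r u x ^ 2) (poissonCounts r) := by
  simp only [sq]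
  refine integrable_centeredSum_mul integrable_centeredSum fun j => ?_
  simp only [centeredSum_add_single]
  exact integrable_centeredSum.add (integrable_const _)

theorem integral_centeredSum_sq :
    ∫ x, centeredSum r u x ^ 2 ∂poissonCounts r = ∑ j, r j * u j ^ 2 := by
  simp only [sq]
  rw [integral_centeredSum_mul integrable_centeredSum fun j => ?_]
  · simp [centeredSum_add_single]
  · simp only [centeredSum_add_single]
    exact integrable_centeredSum.add (integrable_const _)

theorem integral_abs_centeredSum_le_one (hu : ∑ j, r j * u j ^ 2 = 1) :
    ∫ x, |centeredSum r u x| ∂poissonCounts r ≤ 1 := by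
  have h : ∫ x, |centeredSum r u x| ∂poissonCounts r ≤
      ∫ x, (1 + centeredSum r u x ^ 2) / 2 ∂poissonCounts r := by
    refine integral_mono integrable_centeredSum.abs
      (((integrable_const _).add integrable_centeredSum_sq).div_const _) fun x => ?_
    nlinarith [sq_nonneg (|centeredSum r u x| - 1), sq_abs (centeredSum r u x)]
  refine h.trans_eq ?_
  rw [integral_div, integral_add (integrable_const _) integrable_centeredSum_sq,
    integral_centeredSum_sq, hu]
  simp

end

theorem abs_steinSol_sub_le (z x y : ℝ) : |steinSol z y - steinSol z x| ≤ 2 * |y - x| := by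
  rw [steinSol_sub_eq_integral, ← Real.norm_eq_abs]
  refine intervalIntegral.norm_integral_le_of_norm_le_const fun w _ => ?_
  have h1 : |w * steinSol z w| ≤ 1 := by
    rw [abs_mul, abs_of_nonneg (steinSol_nonneg z w)]
    exact abs_mul_steinSol_le_one z w
  have h2 := stdCDF_nonneg z
  have h3 := stdCDF_le_one z
  have h4 : 0 ≤ (Iic z).indicator (1 : ℝ → ℝ) w := indicator_nonneg (fun _ _ => zero_le_one) w
  have h5 : (Iic z).indicator (1 : ℝ → ℝ) w ≤ 1 := indicator_le_self' (by simp) w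
  rw [Real.norm_eq_abs, abs_le]
  rw [abs_le] at h1
  constructor <;> linarith

/-- The modulus of continuity of `w ↦ w f w` for a Stein solution `f`. -/
theorem abs_mul_steinSol_sub_le (z w s : ℝ) :
    |(w + s) * steinSol z (w + s) - w * steinSol z w| ≤
      |s| * ((stdDensity 1)⁻¹ + 2 * |w|) := by
  have h1 := steinSol_le z (w + s)
  have h2 := abs_steinSol_sub_le z w (w + s)
  rw [add_sub_cancel_left] at h2
  calc |(w + s) * steinSol z (w + s) - w * steinSol z w|
      = |s * steinSol z (w + s) + w * (steinSol z (w + s) - steinSol z w)| := by ring_nf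
    _ ≤ |s| * steinSol z (w + s) + |w| * |steinSol z (w + s) - steinSol z w| := by
        refine (abs_add_le _ _).trans_eq ?_
        rw [abs_mul, abs_mul, abs_of_nonneg (steinSol_nonneg z _)]
    _ ≤ |s| * (stdDensity 1)⁻¹ + |w| * (2 * |s|) := by gcongr
    _ = |s| * ((stdDensity 1)⁻¹ + 2 * |w|) := by ring

/-- Bounds on `g` along a step from `w` to `w + u`, of either sign, bound `u` times its integral. -/
theorem mul_integral_mem_Icc {g : ℝ → ℝ} {w u A B : ℝ}
    (hg : IntervalIntegrable g volume w (w + u))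
    (hA : ∀ s, |s| ≤ |u| → A ≤ g (w + s)) (hB : ∀ s, |s| ≤ |u| → g (w + s) ≤ B) :
    u * ∫ t in w..(w + u), g t ∈ Icc (u ^ 2 * A) (u ^ 2 * B) := by
  rcases le_total 0 u with hu | hu
  · have hle : w ≤ w + u := by linarith
    have key : ∀ t ∈ Icc w (w + u), A ≤ g t ∧ g t ≤ B := by
      intro t ht
      have hs : |t - w| ≤ |u| := by
        rw [abs_of_nonneg hu, abs_of_nonneg (by linarith [ht.1])]
        linarith [ht.2]
      simpa using And.intro (hA _ hs) (hB _ hs)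
    have h1 := intervalIntegral.integral_mono_on hle intervalIntegrable_const hg
      fun t ht => (key t ht).1
    have h2 := intervalIntegral.integral_mono_on hle hg intervalIntegrable_const
      fun t ht => (key t ht).2
    rw [intervalIntegral.integral_const, smul_eq_mul, add_sub_cancel_left] at h1 h2
    constructor <;> nlinarith
  · have hle : w + u ≤ w := by linarith
    have key : ∀ t ∈ Icc (w + u) w, A ≤ g t ∧ g t ≤ B := by
      intro t ht
      have hs : |t - w| ≤ |u| := by
        rw [abs_of_nonpos hu, abs_of_nonpos (by linarith [ht.2])]
        linarith [ht.1]
      simpa using And.intro (hA _ hs) (hB _ hs)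
    have h1 := intervalIntegral.integral_mono_on hle intervalIntegrable_const hg.symm
      fun t ht => (key t ht).1
    have h2 := intervalIntegral.integral_mono_on hle hg.symm intervalIntegrable_const
      fun t ht => (key t ht).2
    rw [intervalIntegral.integral_const, smul_eq_mul, sub_add_cancel_left] at h1 h2
    rw [intervalIntegral.integral_symm]
    constructor <;> nlinarith

/-- The increments of a Stein solution are squeezed between multiples of the right-hand side of
the Stein equation, up to moving the jump by `b`. -/
theorem mul_steinSol_sub_mem_Icc (z w : ℝ) {u b : ℝ} (hu : |u| ≤ b) :
    u * (steinSol z (w + u) - steinSol z w) ∈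
      Icc (u ^ 2 * (w * steinSol z w - b * ((stdDensity 1)⁻¹ + 2 * |w|) +
          (Iic (z - b)).indicator 1 w - stdCDF z))
        (u ^ 2 * (w * steinSol z w + b * ((stdDensity 1)⁻¹ + 2 * |w|) +
          (Iic (z + b)).indicator 1 w - stdCDF z)) := by
  rw [steinSol_sub_eq_integral]
  have hmod : ∀ s, |s| ≤ |u| → |(w + s) * steinSol z (w + s) - w * steinSol z w| ≤
      b * ((stdDensity 1)⁻¹ + 2 * |w|) := by
    intro s hs
    have := stdDensity_pos 1
    exact (abs_mul_steinSol_sub_le z w s).trans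
      (mul_le_mul_of_nonneg_right (hs.trans hu) (by positivity))
  refine mul_integral_mem_Icc (intervalIntegrable_stein z w (w + u)) ?_ ?_
  · intro s hs
    have h1 := (abs_le.1 (hmod s hs)).1
    have h2 : (Iic (z - b)).indicator (1 : ℝ → ℝ) w ≤ (Iic z).indicator 1 (w + s) := by
      have hsb := (abs_le.1 (hs.trans hu)).2
      simp only [indicator_apply, mem_Iic, Pi.one_apply]
      split_ifs <;> linarith
    linarith
  · intro s hs
    have h1 := (abs_le.1 (hmod s hs)).2
    have h2 : (Iic z).indicator (1 : ℝ → ℝ) (w + s) ≤ (Iic (z + b)).indicator 1 w := by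
      have hsb := (abs_le.1 (hs.trans hu)).1
      simp only [indicator_apply, mem_Iic, Pi.one_apply]
      split_ifs <;> linarith
    linarith

/-! ### The Berry-Esseen bound -/

/-- The constant in the Berry-Esseen bound for weighted sums of Poisson counts: `1 / φ 1 + 2` comes
from the modulus of continuity of `w ↦ w f w`, and `1` from moving the jump of the indicator. -/
noncomputable def berryEsseenConst : ℝ := (stdDensity 1)⁻¹ + 3

theorem berryEsseenConst_pos : 0 < berryEsseenConst := by
  have := stdDensity_pos 1
  unfold berryEsseenConst
  positivity

/-- The Berry-Esseen bound for a standardized weighted sum of independent Poisson counts, with the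
largest weight as the error. -/
theorem abs_measureReal_centeredSum_le_sub_stdCDF_le {d : ℕ} {r : Fin d → ℝ≥0} {u : Fin d → ℝ}
    {b : ℝ} (hu : ∑ j, r j * u j ^ 2 = 1) (hb0 : 0 ≤ b) (hb : ∀ j, |u j| ≤ b) (z : ℝ) :
    |(poissonCounts r).real {x | centeredSum r u x ≤ z} - stdCDF z| ≤ berryEsseenConst * b := by
  set P := poissonCounts r with hP
  set L := centeredSum r u with hL
  set K := (stdDensity 1)⁻¹ with hK
  have hbdd : ∀ (z : ℝ) (g : Counts d → ℝ), Integrable (fun x => steinSol z (g x)) P := by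
    intro z g
    refine Integrable.of_bound .of_discrete K (Eventually.of_forall fun x => ?_)
    rw [Real.norm_of_nonneg (steinSol_nonneg _ _)]
    exact steinSol_le _ _
  have hprob : ∀ t : ℝ, ∫ x, (Iic t).indicator (1 : ℝ → ℝ) (L x) ∂P = P.real {x | L x ≤ t} := by
    intro t
    rw [← integral_indicator_one (s := {x | L x ≤ t}) (MeasurableSet.of_discrete)]
    rfl
  have hind : ∀ t : ℝ, Integrable (fun x => (Iic t).indicator (1 : ℝ → ℝ) (L x)) P := by
    intro t
    exact (integrable_const (1 : ℝ)).indicator (s := {x | L x ≤ t}) MeasurableSet.of_discrete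
  have hLint : Integrable L P := integrable_centeredSum
  have hLf : ∀ z, Integrable (fun x => L x * steinSol z (L x)) P := fun z =>
    integrable_centeredSum_mul (hbdd z _) fun j => hbdd z _
  have herr : Integrable (fun x => b * (K + 2 * |L x|)) P :=
    ((integrable_const _).add (hLint.abs.const_mul _)).const_mul _
  have herr_le : ∫ x, b * (K + 2 * |L x|) ∂P ≤ (K + 2) * b := by
    rw [integral_const_mul, integral_add (integrable_const _) (hLint.abs.const_mul _),
      integral_const_mul]
    have := integral_abs_centeredSum_le_one hu
    simp only [integral_const, probReal_univ, one_smul]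
    rw [mul_comm]
    exact mul_le_mul_of_nonneg_right (by linarith) hb0
  have hincr : ∀ z, Integrable (fun x =>
      ∑ j, r j * (u j * (steinSol z (L (x + Pi.single j 1)) - steinSol z (L x)))) P := fun z =>
    integrable_finsetSum _ fun j _ => (((hbdd z _).sub (hbdd z _)).const_mul _).const_mul _
  have hstein : ∀ z, ∫ x, L x * steinSol z (L x) ∂P = ∫ x, ∑ j, r j *
      (u j * (steinSol z (L (x + Pi.single j 1)) - steinSol z (L x))) ∂P := fun z =>
    integral_centeredSum_mul (hbdd z _) fun j => hbdd z _
  -- Averaging a bound over `j` with the weights `r j * u j ^ 2`, which sum to one.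
  have havg : ∀ A : ℝ, ∑ j, r j * (u j ^ 2 * A) = A := by
    intro A
    simp only [← mul_assoc]
    rw [← Finset.sum_mul, hu, one_mul]
  have hlow : ∀ z, P.real {x | L x ≤ z - b} ≤ stdCDF z + (K + 2) * b := by
    intro z
    have h1 : Integrable (fun x => L x * steinSol z (L x) - b * (K + 2 * |L x|)) P :=
      (hLf z).sub herr
    have h2 : Integrable (fun x => L x * steinSol z (L x) - b * (K + 2 * |L x|) +
        (Iic (z - b)).indicator 1 (L x)) P := h1.add (hind _)
    have h : ∫ x, (L x * steinSol z (L x) - b * (K + 2 * |L x|) +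
        (Iic (z - b)).indicator 1 (L x) - stdCDF z) ∂P ≤ ∫ x, L x * steinSol z (L x) ∂P := by
      rw [hstein]
      refine integral_mono (h2.sub (integrable_const _))
        (hincr z) fun x => ?_
      simp only [hL, centeredSum_add_single]
      rw [← havg (_ - stdCDF z)]
      exact Finset.sum_le_sum fun j _ => mul_le_mul_of_nonneg_left
        (mul_steinSol_sub_mem_Icc z _ (hb j)).1 (r j).coe_nonneg
    rw [integral_sub h2 (integrable_const _), integral_add h1 (hind _), integral_sub (hLf z) herr,
      hprob] at h
    simp only [integral_const, probReal_univ, one_smul] at h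
    linarith
  have hupp : ∀ z, stdCDF z ≤ P.real {x | L x ≤ z + b} + (K + 2) * b := by
    intro z
    have h1 : Integrable (fun x => L x * steinSol z (L x) + b * (K + 2 * |L x|)) P :=
      (hLf z).add herr
    have h2 : Integrable (fun x => L x * steinSol z (L x) + b * (K + 2 * |L x|) +
        (Iic (z + b)).indicator 1 (L x)) P := h1.add (hind _)
    have h : ∫ x, L x * steinSol z (L x) ∂P ≤ ∫ x, (L x * steinSol z (L x) +
        b * (K + 2 * |L x|) + (Iic (z + b)).indicator 1 (L x) - stdCDF z) ∂P := by
      rw [hstein]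
      refine integral_mono (hincr z)
        (h2.sub (integrable_const _)) fun x => ?_
      simp only [hL, centeredSum_add_single]
      rw [← havg (_ - stdCDF z)]
      exact Finset.sum_le_sum fun j _ => mul_le_mul_of_nonneg_left
        (mul_steinSol_sub_mem_Icc z _ (hb j)).2 (r j).coe_nonneg
    rw [integral_sub h2 (integrable_const _), integral_add h1 (hind _), integral_add (hLf z) herr,
      hprob] at h
    simp only [integral_const, probReal_univ, one_smul] at h
    linarith
  have h1 := hlow (z + b)
  have h2 := hupp (z - b)
  have h3 := stdCDF_add_le z hb0
  have h4 := stdCDF_add_le (z - b) hb0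
  rw [add_sub_cancel_right] at h1
  rw [sub_add_cancel] at h2 h4
  rw [abs_le, berryEsseenConst, ← hK]
  constructor <;> linarith

/-! ### Thinning of Poisson counts -/

/-- The probability that a thinned Poisson count equals `k`, by summing over the original count.
The terms `n < k` vanish, and the rest is a Poisson distribution with rate `(1 - p) r`. -/
theorem hasSum_poisson_mul_binomial (r : ℝ≥0) (p : I) (k : ℕ) :
    HasSum (fun n : ℕ => (n.choose k : ℝ) * (p : ℝ) ^ k * (1 - (p : ℝ)) ^ (n - k) *
        (Real.exp (-r) * r ^ n / n.factorial))
      (Real.exp (-(p * r)) * (p * r) ^ k / k.factorial) := by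
  rw [← hasSum_nat_add_iff' k, Finset.sum_eq_zero, sub_zero]
  · have h := (hasSum_one_poissonMeasure (unitInterval.toNNReal (σ p) * r)).mul_left
      (Real.exp (-(p * r)) * (p * r) ^ k / k.factorial)
    rw [mul_one] at h
    convert! h using 1
    funext m
    have hc : ((m + k).choose k : ℝ) * (m.factorial * k.factorial) = (m + k).factorial := by
      exact_mod_cast (mul_assoc _ _ _).symm.trans (Nat.add_choose_mul_factorial_mul_factorial m k)
    have he : Real.exp (-r) = Real.exp (-(p * r)) * Real.exp (-((1 - p) * r)) := by
      rw [← Real.exp_add]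
      congr 1
      ring
    have h1 : (m.factorial : ℝ) ≠ 0 := by positivity
    have h2 : (k.factorial : ℝ) ≠ 0 := by positivity
    have h4 : ((m + k).choose k : ℝ) = (m + k).factorial / (m.factorial * k.factorial) := by
      rw [← hc]
      field_simp
    rw [h4, he, Nat.add_sub_cancel]
    simp only [NNReal.coe_mul, unitInterval.coe_toNNReal, unitInterval.coe_symm_eq, mul_pow]
    field_simp
    ring
  · intro n hn
    rw [Nat.choose_eq_zero_of_lt (Finset.mem_range.1 hn)]
    simp

/-- Binomial thinning of a Poisson count is Poisson. -/
theorem lintegral_binomial_singleton_poissonMeasure (r : ℝ≥0) (p : I) (k : ℕ) :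
    ∫⁻ n, binomial n p {k} ∂poissonMeasure r =
      poissonMeasure (unitInterval.toNNReal p * r) {k} := by
  have h := hasSum_poisson_mul_binomial r p k
  have hp : 0 ≤ 1 - (p : ℝ) := sub_nonneg.2 p.2.2
  have hp0 : 0 ≤ (p : ℝ) := p.2.1
  rw [lintegral_countable', poissonMeasure_singleton]
  simp only [binomial_singleton, poissonMeasure_singleton]
  rw [NNReal.coe_mul, unitInterval.coe_toNNReal, ← h.tsum_eq,
    ENNReal.ofReal_tsum_of_nonneg (fun n => by positivity) h.summable]
  exact tsum_congr fun n => (ENNReal.ofReal_mul (by positivity)).symm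

/-- Binomial dropout of independent Poisson counts gives independent Poisson counts, with the
rates multiplied by the probability of keeping a word. -/
theorem binomialDropout_comp_poissonCounts {d : ℕ} (δ : I) (r : Fin d → ℝ≥0) :
    (poissonCounts r).bind (binomialDropout d δ) =
      poissonCounts (fun j => unitInterval.toNNReal (σ δ) * r j) := by
  refine Measure.ext_of_singleton fun y => ?_
  rw [Measure.bind_apply (measurableSet_singleton y) (Kernel.aemeasurable _),
    poissonCounts_singleton]
  have h1 : ∀ x : Counts d, binomialDropout d δ x {y} = ∏ j, binomial (x j) (σ δ) {y j} :=
    fun x => Measure.pi_singleton _ _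
  have hind : iIndepFun (fun j (x : Counts d) => binomial (x j) (σ δ) {y j}) (poissonCounts r) :=
    iIndepFun_pi (X := fun j n => binomial n (σ δ) {y j}) fun j => .of_discrete
  simp only [h1]
  rw [lintegral_prod_eq_prod_lintegral_of_indepFun _ _ hind fun j => .of_discrete]
  refine Finset.prod_congr rfl fun j _ => ?_
  rw [← lintegral_binomial_singleton_poissonMeasure, poissonCounts,
    ← (measurePreserving_eval (fun j => poissonMeasure (r j)) j).lintegral_comp .of_discrete]

/-! ### Error rates of linear classifiers as Gaussian tails -/

/-- The sign that turns the standardized threshold `-mean / deviation` into the argument of the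
Gaussian tail: the error event for the label `1` is a lower tail, for the label `0` an upper one. -/
def errorSign (c : Bool) : ℝ := if c then 1 else -1

/-- The error probability of a linear classifier under independent Poisson counts is a Gaussian
tail up to the Berry-Esseen error. -/
theorem abs_measureReal_linearPrediction_ne_sub_stdCDF_le {d : ℕ} {r : Fin d → ℝ≥0}
    {w : Fin d → ℝ} (hw : 0 < ∑ j, (r j : ℝ) * w j ^ 2) (c : Bool) :
    |(poissonCounts r).real {x | linearPrediction w x ≠ c} -
        stdCDF (errorSign c * (-(∑ j, r j * w j) / √(∑ j, (r j : ℝ) * w j ^ 2)))| ≤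
      berryEsseenConst * √((⨆ j, w j ^ 2) / ∑ j, (r j : ℝ) * w j ^ 2) := by
  set B := ∑ j, (r j : ℝ) * w j ^ 2 with hB
  have hs : 0 < √B := Real.sqrt_pos.2 hw
  have hu : ∑ j, (r j : ℝ) * (w j / √B) ^ 2 = 1 := by
    simp only [div_pow, Real.sq_sqrt hw.le, ← mul_div_assoc]
    rw [← Finset.sum_div, ← hB, div_self hw.ne']
  have hb : ∀ j, |w j / √B| ≤ √((⨆ j, w j ^ 2) / B) := by
    intro j
    rw [← Real.sqrt_sq_eq_abs, div_pow, Real.sq_sqrt hw.le]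
    refine Real.sqrt_le_sqrt (div_le_div_of_nonneg_right ?_ hw.le)
    exact le_ciSup (f := fun j => w j ^ 2) (Set.finite_range _).bddAbove j
  have h := abs_measureReal_centeredSum_le_sub_stdCDF_le hu (Real.sqrt_nonneg _) hb
    (-(∑ j, r j * w j) / √B)
  have hset : {x | centeredSum r (fun j => w j / √B) x ≤ -(∑ j, r j * w j) / √B} =
      {x : Counts d | ∑ j, w j * (x j : ℝ) ≤ 0} := by
    ext x
    have he : centeredSum r (fun j => w j / √B) x =
        (∑ j, w j * (x j : ℝ)) / √B + -(∑ j, r j * w j) / √B := by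
      rw [centeredSum, ← add_div, ← sub_eq_add_neg, ← Finset.sum_sub_distrib, Finset.sum_div]
      exact Finset.sum_congr rfl fun j _ => by ring
    rw [mem_ofPred_eq, mem_ofPred_eq, he, add_le_iff_nonpos_left, div_le_iff₀ hs, zero_mul]
  rw [hset] at h
  cases c
  · have hc : {x : Counts d | linearPrediction w x ≠ false} =
        {x : Counts d | ∑ j, w j * (x j : ℝ) ≤ 0}ᶜ := by
      ext x
      simp [linearPrediction]
    rw [hc, probReal_compl_eq_one_sub .of_discrete, errorSign, if_neg (by simp), neg_one_mul,
      stdCDF_neg, sub_sub_sub_cancel_left, abs_sub_comm]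
    exact h
  · have hc : {x : Counts d | linearPrediction w x ≠ true} =
        {x : Counts d | ∑ j, w j * (x j : ℝ) ≤ 0} := by
      ext x
      simp [linearPrediction]
    rw [hc, errorSign, if_pos rfl, one_mul]
    exact h

/-! ### Comparison of Gaussian tails -/

/-- Comparison of Gaussian tails at `x` and at `x / √(1 - δ)`, where the smaller tail is bounded by
a power of any `e` within constant factors of the larger one. -/
theorem stdCDF_le_const_mul_rpow {δ x e : ℝ} (hδ₀ : 0 < δ) (hδ₁ : δ < 1) (hx : 2 ≤ x)
    (he : stdCDF (-x) / 2 ≤ e) (he' : e ≤ 3 / 2 * stdCDF (-x)) :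
    stdCDF (-(x / √(1 - δ))) ≤
      (4 * √(2 * Real.pi)) ^ (1 / (1 - δ)) * 2 ^ (δ / (1 - δ)) *
        (e ^ (1 / (1 - δ)) * √(-Real.log e) ^ (δ / (1 - δ))) := by
  set p := 1 - δ with hp
  have hp0 : 0 < p := by linarith
  have hp1 : √p ≤ 1 := Real.sqrt_le_one.2 (by linarith)
  have hsp : 0 < √p := Real.sqrt_pos.2 hp0
  have hx0 : 0 < x := by linarith
  have hq0 : 0 < stdCDF (-x) := stdCDF_pos _
  have he0 : 0 < e := by linarith
  have hpi : 0 < √(2 * Real.pi) := by positivity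
  have hpi1 : 1 ≤ √(2 * Real.pi) := Real.one_le_sqrt.2 (by linarith [Real.pi_gt_three])
  -- The upper Mills bound on the left-hand side.
  have hleft : stdCDF (-(x / √p)) ≤ Real.exp (-x ^ 2 / 2 / p) / x := by
    have h := mul_stdCDF_neg_le (x := x / √p) (by positivity)
    have h2 := stdDensity_le_exp (x / √p)
    rw [div_pow, Real.sq_sqrt hp0.le] at h2
    have h3 : x ≤ x / √p := by rw [le_div_iff₀ hsp]; nlinarith
    rw [le_div_iff₀ hx0, mul_comm]
    calc x * stdCDF (-(x / √p)) ≤ x / √p * stdCDF (-(x / √p)) :=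
          mul_le_mul_of_nonneg_right h3 (stdCDF_nonneg _)
      _ ≤ Real.exp (-(x ^ 2 / p) / 2) := h.trans h2
      _ = Real.exp (-x ^ 2 / 2 / p) := by congr 1; ring
  -- The lower Mills bound on the base `e`.
  have hbase : Real.exp (-x ^ 2 / 2) / (4 * √(2 * Real.pi) * x) ≤ e := by
    have h := le_stdCDF_neg x
    have h2 : 1 / (2 * x) ≤ x / (1 + x ^ 2) := by
      rw [div_le_div_iff₀ (by positivity) (by positivity)]
      nlinarith
    have h3 := (mul_le_mul_of_nonneg_left h2 (stdDensity_pos x).le).trans h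
    rw [stdDensity_eq] at h3
    calc Real.exp (-x ^ 2 / 2) / (4 * √(2 * Real.pi) * x)
        = (√(2 * Real.pi))⁻¹ * Real.exp (-x ^ 2 / 2) * (1 / (2 * x)) / 2 := by field_simp; ring
      _ ≤ stdCDF (-x) / 2 := by linarith
      _ ≤ e := he
  have hpow : Real.exp (-x ^ 2 / 2 / p) / ((4 * √(2 * Real.pi)) ^ (1 / p) * x ^ (1 / p)) ≤
      e ^ (1 / p) := by
    have h := Real.rpow_le_rpow (by positivity) hbase (z := 1 / p) (by positivity)
    rwa [Real.div_rpow (Real.exp_pos _).le (by positivity), ← Real.exp_mul,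
      Real.mul_rpow (by positivity) hx0.le, mul_one_div] at h
  -- The upper Mills bound makes the logarithm large.
  have hlog : x / 2 ≤ √(-Real.log e) := by
    have h1 : stdCDF (-x) ≤ Real.exp (-x ^ 2 / 2) := by
      have h := (mul_stdCDF_neg_le hx0).trans (stdDensity_le_exp x)
      nlinarith
    have h2 : (3 / 2 : ℝ) ≤ Real.exp 1 := by linarith [Real.add_one_le_exp (1 : ℝ)]
    have h3 : e ≤ Real.exp (-(x / 2) ^ 2) := by
      calc e ≤ Real.exp 1 * Real.exp (-x ^ 2 / 2) :=
            he'.trans (mul_le_mul h2 h1 hq0.le (Real.exp_pos _).le)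
        _ = Real.exp (1 + -x ^ 2 / 2) := (Real.exp_add _ _).symm
        _ ≤ Real.exp (-(x / 2) ^ 2) := Real.exp_le_exp.2 (by nlinarith)
    refine Real.le_sqrt_of_sq_le ?_
    have := (Real.log_le_iff_le_exp he0).2 h3
    linarith
  have hlogpow : x ^ (δ / p) / 2 ^ (δ / p) ≤ √(-Real.log e) ^ (δ / p) := by
    rw [← Real.div_rpow hx0.le zero_le_two]
    exact Real.rpow_le_rpow (by positivity) hlog (by positivity)
  have hx1 : x ^ (1 / p) = x ^ (δ / p) * x := by
    conv_rhs => rw [← Real.rpow_one x, ← Real.rpow_mul hx0.le, one_mul]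
    rw [← Real.rpow_add hx0]
    congr 1
    field_simp
    linarith
  calc stdCDF (-(x / √p)) ≤ Real.exp (-x ^ 2 / 2 / p) / x := hleft
    _ = (4 * √(2 * Real.pi)) ^ (1 / p) * 2 ^ (δ / p) *
        (Real.exp (-x ^ 2 / 2 / p) / ((4 * √(2 * Real.pi)) ^ (1 / p) * x ^ (1 / p)) *
          (x ^ (δ / p) / 2 ^ (δ / p))) := by
        rw [hx1]
        have : 0 < x ^ (δ / p) := by positivity
        have : 0 < (4 * √(2 * Real.pi)) ^ (1 / p) := by positivity
        have : (0 : ℝ) < 2 ^ (δ / p) := by positivity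
        field_simp
    _ ≤ _ := by gcongr

/-- The analytic form of the result: `ε` and `e` are arbitrary numbers close to the Gaussian tails
`Φ s` and `Φ (√(1 - δ) s)`. -/
theorem le_const_mul_of_near_stdCDF {δ K : ℝ} (hδ₀ : 0 < δ) (hδ₁ : δ < 1) (hK : 0 < K) :
    ∃ C : ℝ, 0 < C ∧ ∀ s b ε e : ℝ, 0 ≤ b → ε ≤ 1 → 0 ≤ e →
      ε ≤ stdCDF s + K * b → |e - stdCDF (√(1 - δ) * s)| ≤ K * b →
      ε ≤ C * (e ^ (1 / (1 - δ)) * max 1 (√(-Real.log e) ^ (δ / (1 - δ))) + b) := by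
  set p := 1 - δ with hp
  have hp0 : 0 < p := by linarith
  have hsp : 0 < √p := Real.sqrt_pos.2 hp0
  have hsp1 : √p ≤ 1 := Real.sqrt_le_one.2 (by linarith)
  set a := stdCDF (-2) / 2 with ha
  have ha0 : 0 < a := half_pos (stdCDF_pos _)
  set C₁ := (a ^ (1 / p))⁻¹ with hC₁
  set C₂ := (4 * √(2 * Real.pi)) ^ (1 / p) * 2 ^ (δ / p) with hC₂
  have hC₁0 : 0 < C₁ := by positivity
  have hC₂0 : 0 < C₂ := by positivity
  refine ⟨4 * K + C₁ + C₂, by positivity, fun s b ε e hb hε1 he0 hε he => ?_⟩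
  set L := max 1 (√(-Real.log e) ^ (δ / p)) with hL
  have hL1 : 1 ≤ L := le_max_left _ _
  have hE : 0 ≤ e ^ (1 / p) * L := by positivity
  set q := stdCDF (√p * s) with hq
  obtain ⟨he1, he2⟩ := abs_le.1 he
  have hKb : 0 ≤ K * b := by positivity
  have hsplit : (4 * K + C₁ + C₂) * (e ^ (1 / p) * L + b) =
      4 * (K * b) + C₁ * (e ^ (1 / p) * L) + C₂ * (e ^ (1 / p) * L) +
        (4 * K * (e ^ (1 / p) * L) + (C₁ + C₂) * b) := by ring
  have hrest : 0 ≤ 4 * K * (e ^ (1 / p) * L) + (C₁ + C₂) * b := by positivity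
  have hT₁ : 0 ≤ C₁ * (e ^ (1 / p) * L) := by positivity
  have hT₂ : 0 ≤ C₂ * (e ^ (1 / p) * L) := by positivity
  rw [hsplit]
  rcases le_or_gt q (2 * (K * b)) with hqb | hqb
  · -- The Gaussian tail is dominated by the approximation error.
    rcases le_total s 0 with hs | hs
    · have : stdCDF s ≤ q := monotone_stdCDF (by nlinarith)
      linarith
    · have h0 : stdCDF 0 ≤ q := monotone_stdCDF (by positivity)
      have h1 := stdCDF_neg 0
      rw [neg_zero] at h1
      linarith
  · rcases le_or_gt (-2) (√p * s) with hs | hs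
    · -- Both tails are bounded away from zero.
      have h1 : a ≤ e := by
        have : stdCDF (-2) ≤ q := monotone_stdCDF hs
        linarith
      have h2 : a ^ (1 / p) ≤ e ^ (1 / p) * L :=
        (Real.rpow_le_rpow ha0.le h1 (by positivity)).trans
          (le_mul_of_one_le_right (by positivity) hL1)
      have h3 : 1 ≤ C₁ * (e ^ (1 / p) * L) := by
        rw [hC₁, ← div_eq_inv_mul, one_le_div (by positivity)]
        exact h2
      linarith
    · have h := stdCDF_le_const_mul_rpow (x := -(√p * s)) (e := e) hδ₀ hδ₁ (by linarith)
        (by rw [neg_neg]; linarith) (by rw [neg_neg]; linarith)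
      rw [← hp, neg_div, neg_neg, mul_div_cancel_left₀ _ hsp.ne'] at h
      have h2 : C₂ * (e ^ (1 / p) * √(-Real.log e) ^ (δ / p)) ≤ C₂ * (e ^ (1 / p) * L) := by
        gcongr
        exact le_max_right _ _
      linarith

theorem theorem1 (δ : I) (hδ₀ : 0 < δ) (hδ₁ : δ < 1) :
    ∃ C : ℝ, 0 < C ∧
      ∀ (Θ : Type*) [MeasurableSpace Θ] (d : ℕ) (M : PoissonTopicModel Θ d)
        (w : Fin d → ℝ) (τ : Θ) (c : Bool),
        M.IsMostLikelyLabel τ c →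
        0 < ∑ j, (M.rate τ j : ℝ) * w j ^ 2 →
        M.errorRate w τ c ≤
          C * (M.dropoutErrorRate δ w τ c ^ (1 / (1 - (δ : ℝ))) *
                max 1 (√(-Real.log (M.dropoutErrorRate δ w τ c)) ^ ((δ : ℝ) / (1 - (δ : ℝ)))) +
              √(M.weightImbalance w τ)) := by
  have hδ₀' : (0 : ℝ) < δ := hδ₀
  have hδ₁' : (δ : ℝ) < 1 := hδ₁
  set p : ℝ := 1 - δ with hp
  have hp0 : 0 < p := by linarith
  have hsp : 0 < √p := Real.sqrt_pos.2 hp0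
  have hsp1 : √p ≤ 1 := Real.sqrt_le_one.2 (by linarith)
  have hK := berryEsseenConst_pos
  obtain ⟨C, hC, H⟩ := le_const_mul_of_near_stdCDF hδ₀' hδ₁' (K := berryEsseenConst / √p)
    (by positivity)
  refine ⟨C, hC, fun Θ _ d M w τ c _ hw => ?_⟩
  set B := ∑ j, (M.rate τ j : ℝ) * w j ^ 2 with hB
  set m := ∑ j, (M.rate τ j : ℝ) * w j with hm
  set r' : Fin d → ℝ≥0 := fun j => unitInterval.toNNReal (σ δ) * M.rate τ j with hr'
  have hB' : ∑ j, (r' j : ℝ) * w j ^ 2 = p * B := by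
    rw [hB, Finset.mul_sum]
    exact Finset.sum_congr rfl fun j _ => by simp [hr', hp, mul_assoc]
  have hm' : ∑ j, (r' j : ℝ) * w j = p * m := by
    rw [hm, Finset.mul_sum]
    exact Finset.sum_congr rfl fun j _ => by simp [hr', hp, mul_assoc]
  have h1 := abs_measureReal_linearPrediction_ne_sub_stdCDF_le hw c
  have h2 := abs_measureReal_linearPrediction_ne_sub_stdCDF_le (r := r') (w := w)
    (by rw [hB']; positivity) c
  have hlaw : M.dropoutFeaturesGivenTopic δ τ = poissonCounts r' :=
    (Kernel.comp_apply _ _ _).trans (binomialDropout_comp_poissonCounts δ (M.rate τ))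
  refine H (errorSign c * (-m / √B)) (√(M.weightImbalance w τ)) _ _ (Real.sqrt_nonneg _)
    (measureReal_le_one (μ := poissonCounts (M.rate τ))) measureReal_nonneg ?_ ?_
  · have h3 : berryEsseenConst ≤ berryEsseenConst / √p := by
      rw [le_div_iff₀ hsp]
      nlinarith
    have h4 := mul_le_mul_of_nonneg_right h3 (Real.sqrt_nonneg (M.weightImbalance w τ))
    have h5 := (abs_le.1 h1).2
    change _ - _ ≤ berryEsseenConst * √(M.weightImbalance w τ) at h5
    change (poissonCounts (M.rate τ)).real _ ≤ _
    linarith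
  · rw [hB', hm', ← hlaw] at h2
    -- Thinning scales the mean and the variance by `p`, hence the standardized margin by `√p`.
    have hs : √p * (errorSign c * (-m / √B)) = errorSign c * (-(p * m) / √(p * B)) := by
      have hsB : 0 < √B := Real.sqrt_pos.2 hw
      have hpp : √p * √p = p := Real.mul_self_sqrt hp0.le
      rw [Real.sqrt_mul hp0.le]
      nth_rewrite 2 [← hpp]
      field_simp
    have hb : berryEsseenConst / √p * √(M.weightImbalance w τ) =
        berryEsseenConst * √((⨆ j, w j ^ 2) / (p * B)) := by
      rw [mul_comm p B, ← div_div, Real.sqrt_div' _ hp0.le, PoissonTopicModel.weightImbalance]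
      ring
    rw [hb, ← hp, hs]
    exact h2
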